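/- Let $n\ge 1$, let $\mathfrak{gl}_{2n}=\mathfrak{gl}_{2n}(\mathbb{C})$ with matrix units $E_{i,j}$, and put $E_i=E_{i,i+1}$, $F_i=E_{i+1,i}$ $(1\le i\le 2n-1)$ and $H_i=E_{i,i}$ $(1\le i\le 2n)$. Let $\theta$ be the Lie algebra automorphism of $\mathfrak{gl}_{2n}$ with $\theta(E_i)=F_{2n-i}$, $\theta(F_i)=E_{2n-i}$, $\theta(H_i)=H_{2n+1-i}$, and let $\mathfrak{gl}_{2n}^{\theta}=\{x\in\mathfrak{gl}_{2n} : \theta(x)=x\}$. Define the following elements of $\mathfrak{gl}_{2n}^{\theta}$: $$\mathbf e_i=E_i+F_{2n-i},\quad \mathbf f_i=F_i+E_{2n-i}\quad(1\le i\le n-1),\qquad \mathbf t=E_n+F_n,\qquad \mathbf d_i=H_i+H_{2n+1-i}\quad(1\le i\le n).$$ Then the universal enveloping algebra $U(\mathfrak{gl}_{2n}^{\theta})$ is generated, as an associative unital $\mathbb{C}$-algebra, by $\mathbf e_1,\dots,\mathbf e_{n-1}$, $\mathbf f_1,\dots,\mathbf f_{n-1}$, $\mathbf t$, $\mathbf d_1,\dots,\mathbf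 d_n$, and the following is a complete set of defining relations among these generators (all indices of $\mathbf e,\mathbf f$ range over $1,\dots,n-1$ and all indices of $\mathbf d$ over $1,\dots,n$, unless restricted further; relations that involve $\mathbf e_{n-1}$ or $\mathbf f_{n-1}$ are absent when $n=1$): (R1) $\mathbf t\mathbf d_i=\mathbf d_i\mathbf t$; $\ \mathbf d_i\mathbf e_j-\mathbf e_j\mathbf d_i=(\delta_{i,j}-\delta_{i,j+1})\mathbf e_j$; $\ \mathbf d_i\mathbf f_j-\mathbf f_j\mathbf d_i=(-\delta_{i,j}+\delta_{i,j+1})\mathbf f_j$. (R2) $\mathbf t\mathbf e_i=\mathbf e_i\mathbf t$ and $\mathbf t\mathbf f_i=\mathbf f_i\mathbf t$ for $1\le i\le n-2$; $\ \mathbf e_i\mathbf e_j=\mathbf e_j\mathbf e_i$ and $\mathbf f_i\mathbf f_j=\mathbf f_j\mathbf f_i$ for $|i-j|>1$; $\ \mathbf e_i\mathbf f_j-\mathbf f_j\mathbf e_i=\delta_{i,j}(\mathbf d_i-\mathbf d_{i+1})$. (R3) $\mathbf e_i^2\mathbf e_j-2\mathbf e_i\mathbf e_j\mathbf e_i+\mathbf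 e_j\mathbf e_i^2=0$ and $\mathbf f_i^2\mathbf f_j-2\mathbf f_i\mathbf f_j\mathbf f_i+\mathbf f_j\mathbf f_i^2=0$ for $|i-j|=1$; $\ \mathbf e_{n-1}^2\mathbf t-2\mathbf e_{n-1}\mathbf t\mathbf e_{n-1}+\mathbf t\mathbf e_{n-1}^2=0$; $\ \mathbf f_{n-1}^2\mathbf t-2\mathbf f_{n-1}\mathbf t\mathbf f_{n-1}+\mathbf t\mathbf f_{n-1}^2=0$. (R4) $\mathbf e_{n-1}\mathbf t^2-2\mathbf t\mathbf e_{n-1}\mathbf t+\mathbf t^2\mathbf e_{n-1}=\mathbf e_{n-1}$; $\ \mathbf f_{n-1}\mathbf t^2-2\mathbf t\mathbf f_{n-1}\mathbf t+\mathbf t^2\mathbf f_{n-1}=\mathbf f_{n-1}$. -/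

import Mathlib

namespace EvenFixedPoint

attribute [local instance 100] LieRing.ofAssociativeRing

/-! ### The involution on `gl_{2n}` and its fixed points -/

/-- The Lie algebra `gl_{2n}(ℂ)` of complex `2n × 2n` matrices with the commutator bracket. -/
abbrev Gl (n : ℕ) : Type := Matrix (Fin (2 * n)) (Fin (2 * n)) ℂ

/-- The matrix unit `E_{i,j}` of `gl_{2n}`, with rows and columns numbered `1, …, 2n`. -/
def matUnit (n i j : ℕ) : Gl n :=
  Matrix.of fun a b => if (a : ℕ) + 1 = i ∧ (b : ℕ) + 1 = j then 1 else 0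

/-- The Chevalley generator `E_i = E_{i,i+1}`, `1 ≤ i ≤ 2n - 1`. -/
def chevE (n i : ℕ) : Gl n := matUnit n i (i + 1)

/-- The Chevalley generator `F_i = E_{i+1,i}`, `1 ≤ i ≤ 2n - 1`. -/
def chevF (n i : ℕ) : Gl n := matUnit n (i + 1) i

/-- The Chevalley generator `H_i = E_{i,i}`, `1 ≤ i ≤ 2n`. -/
def chevH (n i : ℕ) : Gl n := matUnit n i i

/-- The Lie algebra automorphism `θ` of `gl_{2n}(ℂ)` that reverses the order of the basis,
`E_{i,j} ↦ E_{2n+1-i,2n+1-j}`. It is the one with `θ(E_i) = F_{2n-i}`, `θ(F_i) = E_{2n-i}`,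
`θ(H_i) = H_{2n+1-i}`; see `theta_chevE`, `theta_chevF` and `theta_chevH` below. -/
def theta (n : ℕ) : Gl n ≃ₗ⁅ℂ⁆ Gl n := Matrix.reindexLieEquiv Fin.revPerm

theorem theta_matUnit (n i j : ℕ) (hi : i ≤ 2 * n) (hj : j ≤ 2 * n) :
    theta n (matUnit n i j) = matUnit n (2 * n + 1 - i) (2 * n + 1 - j) := by
  ext a b
  have ha := a.2
  have hb := b.2
  simp only [theta, matUnit, Matrix.reindexLieEquiv_apply, Matrix.reindex_apply,
    Matrix.submatrix_apply, Matrix.of_apply, Fin.revPerm_symm, Fin.revPerm_apply, Fin.val_rev]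
  congr 1
  apply propext
  constructor <;> rintro ⟨h1, h2⟩ <;> constructor <;> omega

theorem theta_chevE (n i : ℕ) (h : i + 1 ≤ 2 * n) :
    theta n (chevE n i) = chevF n (2 * n - i) := by
  rw [chevE, chevF, theta_matUnit n _ _ (by omega) h]
  congr 1 <;> omega

theorem theta_chevF (n i : ℕ) (h : i + 1 ≤ 2 * n) :
    theta n (chevF n i) = chevE n (2 * n - i) := by
  rw [chevE, chevF, theta_matUnit n _ _ h (by omega)]
  congr 1 <;> omega

theorem theta_chevH (n i : ℕ) (h : i ≤ 2 * n) :
    theta n (chevH n i) = chevH n (2 * n + 1 - i) :=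
  theta_matUnit n _ _ h h

/-- The fixed-point subalgebra `gl_{2n}^θ = {x | θ x = x}`. -/
def fixedSubalgebra (n : ℕ) : LieSubalgebra ℂ (Gl n) where
  carrier := {x | theta n x = x}
  add_mem' {x y} hx hy := by
    simp only [Set.mem_ofPred_eq] at hx hy ⊢
    rw [map_add, hx, hy]
  zero_mem' := map_zero _
  smul_mem' c x hx := by
    simp only [Set.mem_ofPred_eq] at hx ⊢
    rw [map_smul, hx]
  lie_mem' {x y} hx hy := by
    have hx' : theta n x = x := hx
    have hy' : theta n y = y := hy
    change theta n ⁅x, y⁆ = ⁅x, y⁆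
    rw [LieEquiv.map_lie, hx', hy']

theorem mem_fixedSubalgebra (n : ℕ) (x : Gl n) : x ∈ fixedSubalgebra n ↔ theta n x = x :=
  Iff.rfl

/-! ### The generators -/

/-- The generating symbols. The index `i` starts at `0`: `e i`, `f i`, `d i` stand for
`e_{i+1}`, `f_{i+1}`, `d_{i+1}`. -/
inductive Gen (n : ℕ) : Type
  | e (i : Fin (n - 1))
  | f (i : Fin (n - 1))
  | t
  | d (i : Fin n)

/-- The matrices `e_i = E_i + F_{2n-i}`, `f_i = F_i + E_{2n-i}` (`1 ≤ i ≤ n - 1`),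
`t = E_n + F_n` and `d_i = H_i + H_{2n+1-i}` (`1 ≤ i ≤ n`). -/
def genMat (n : ℕ) : Gen n → Gl n
  | .e i => chevE n (i + 1) + chevF n (2 * n - (i + 1))
  | .f i => chevF n (i + 1) + chevE n (2 * n - (i + 1))
  | .t => chevE n n + chevF n n
  | .d i => chevH n (i + 1) + chevH n (2 * n + 1 - (i + 1))

theorem genMat_mem (n : ℕ) (g : Gen n) : genMat n g ∈ fixedSubalgebra n := by
  rw [mem_fixedSubalgebra]
  cases g with
  | e i =>
    have hi := i.2
    rw [genMat, map_add, theta_chevE n _ (by omega), theta_chevF n _ (by omega),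
      show 2 * n - (2 * n - ((i : ℕ) + 1)) = i + 1 by omega, add_comm]
  | f i =>
    have hi := i.2
    rw [genMat, map_add, theta_chevE n _ (by omega), theta_chevF n _ (by omega),
      show 2 * n - (2 * n - ((i : ℕ) + 1)) = i + 1 by omega, add_comm]
  | t =>
    rcases Nat.eq_zero_or_pos n with rfl | hn
    · ext a b
      exact absurd a.2 (by omega)
    · rw [genMat, map_add, theta_chevE n _ (by omega), theta_chevF n _ (by omega),
        show 2 * n - n = n by omega, add_comm]
  | d i =>
    have hi := i.2
    rw [genMat, map_add, theta_chevH n _ (by omega), theta_chevH n _ (by omega),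
      show 2 * n + 1 - (2 * n + 1 - ((i : ℕ) + 1)) = i + 1 by omega, add_comm]

/-- The universal enveloping algebra `U(gl_{2n}^θ)`. -/
abbrev Ui (n : ℕ) : Type := UniversalEnvelopingAlgebra ℂ (fixedSubalgebra n)

/-- The elements `e_i`, `f_i`, `t`, `d_i` of `U(gl_{2n}^θ)`. -/
noncomputable def genU (n : ℕ) (g : Gen n) : Ui n :=
  UniversalEnvelopingAlgebra.ι ℂ (⟨genMat n g, genMat_mem n g⟩ : fixedSubalgebra n)

/-! ### The presentation -/

/-- The free associative unital algebra on the symbols. -/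
abbrev Free (n : ℕ) : Type := FreeAlgebra ℂ (Gen n)

section Symbols

variable {n : ℕ}

noncomputable def e (i : Fin (n - 1)) : Free n := FreeAlgebra.ι ℂ (Gen.e i)

noncomputable def f (i : Fin (n - 1)) : Free n := FreeAlgebra.ι ℂ (Gen.f i)

noncomputable def t : Free n := FreeAlgebra.ι ℂ Gen.t

noncomputable def d (i : Fin n) : Free n := FreeAlgebra.ι ℂ (Gen.d i)

end Symbols

/-- Kronecker's `δ_{i,j}`. -/
def delta (i j : ℕ) : ℂ := if i = j then 1 else 0

/-- The defining relations. Since the indices start at `0`, the conditions `1 ≤ i ≤ n - 2` and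
`i = n - 1` on an index of an `e` or `f` read `i + 2 < n` and `i + 2 = n`. -/
inductive Rel (n : ℕ) : Free n → Free n → Prop
  -- (R1)
  | t_d (i : Fin n) : Rel n (t * d i) (d i * t)
  | d_e (i : Fin n) (j : Fin (n - 1)) :
      Rel n (d i * e j - e j * d i) ((delta i j - delta i (j + 1)) • e j)
  | d_f (i : Fin n) (j : Fin (n - 1)) :
      Rel n (d i * f j - f j * d i) ((-delta i j + delta i (j + 1)) • f j)
  -- (R2)
  | t_e (i : Fin (n - 1)) (hi : (i : ℕ) + 2 < n) : Rel n (t * e i) (e i * t)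
  | t_f (i : Fin (n - 1)) (hi : (i : ℕ) + 2 < n) : Rel n (t * f i) (f i * t)
  | e_e (i j : Fin (n - 1)) (hij : 1 < |(i : ℤ) - (j : ℤ)|) : Rel n (e i * e j) (e j * e i)
  | f_f (i j : Fin (n - 1)) (hij : 1 < |(i : ℤ) - (j : ℤ)|) : Rel n (f i * f j) (f j * f i)
  | e_f (i j : Fin (n - 1)) :
      Rel n (e i * f j - f j * e i)
        (delta i j • (d ⟨i, by omega⟩ - d ⟨i + 1, by omega⟩))
  -- (R3): Serre relations among the `e`, among the `f`, and with `t`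
  | serre_e (i j : Fin (n - 1)) (hij : |(i : ℤ) - (j : ℤ)| = 1) :
      Rel n (e i ^ 2 * e j - 2 * (e i * e j * e i) + e j * e i ^ 2) 0
  | serre_f (i j : Fin (n - 1)) (hij : |(i : ℤ) - (j : ℤ)| = 1) :
      Rel n (f i ^ 2 * f j - 2 * (f i * f j * f i) + f j * f i ^ 2) 0
  | e_e_t (i : Fin (n - 1)) (hi : (i : ℕ) + 2 = n) :
      Rel n (e i ^ 2 * t - 2 * (e i * t * e i) + t * e i ^ 2) 0
  | f_f_t (i : Fin (n - 1)) (hi : (i : ℕ) + 2 = n) :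
      Rel n (f i ^ 2 * t - 2 * (f i * t * f i) + t * f i ^ 2) 0
  -- (R4)
  | e_t_t (i : Fin (n - 1)) (hi : (i : ℕ) + 2 = n) :
      Rel n (e i * t ^ 2 - 2 * (t * e i * t) + t ^ 2 * e i) (e i)
  | f_t_t (i : Fin (n - 1)) (hi : (i : ℕ) + 2 = n) :
      Rel n (f i * t ^ 2 - 2 * (t * f i * t) + t ^ 2 * f i) (f i)

/-- The associative unital algebra with generators `e_i`, `f_i`, `t`, `d_i` and relations `Rel`. -/
abbrev Presented (n : ℕ) : Type := RingQuot (Rel n)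

/-- The class of a generating symbol in the presented algebra. -/
noncomputable def Presented.gen (n : ℕ) (g : Gen n) : Presented n :=
  RingQuot.mkAlgHom ℂ (Rel n) (FreeAlgebra.ι ℂ g)

end EvenFixedPoint

/-!
Ordering the indices as `1, …, n, 2n, …, n + 1`, the fixed points of `theta` are the block matrices
`[[a, b], [b, a]]`, that is, `gl_n ⊗ ℂ[ε]` with `ε² = 1`, and `t` is `ε E n n`. In any algebra which
satisfies the relations, `d`, `e` and `f` generate elements `X i j` that bracket like the matrix
units `E i j`: add one row and one column at a time, the Serre relations making the new column and
the new row copies of the standard module and its dual. The relations involving `t` say that `t`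
generates under the `X i j` a second family `B i j` that transforms as the matrix units do, with
`B n n = t`. Then (R4) yields `⁅B i j, B k l⁆ = ⁅X i j, X k l⁆`, so `E i j ↦ X i j` and
`ε E i j ↦ B i j` define a Lie homomorphism on the fixed points. Its extension to the enveloping
algebra is inverse to the evident map from the presented algebra.
-/

namespace EvenFixedPoint

attribute [local instance 100] LieRing.ofAssociativeRing

section UnitBrackets

variable {L M ι κ : Type*} [LieRing L] [AddCommGroup M] [LieRingModule L M]
  [DecidableEq ι] [DecidableEq κ]

/-- The brackets `⁅X i j, Y k l⁆` are those of matrix units,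
`⁅E i j, E k l⁆ = δ_{jk} E i l - δ_{li} E k j`, with values in the family `Z`. -/
def UnitBrackets (X : ι → ι → L) (Y Z : ι → ι → M) : Prop :=
  ∀ i j k l, ⁅X i j, Y k l⁆ = (if j = k then Z i l else 0) - (if l = i then Z k j else 0)

/-- The elements `X i j` satisfy the commutation relations of the matrix units `E i j`. They may
vanish or be linearly dependent. -/
abbrev IsMatrixUnits (X : ι → ι → L) : Prop := UnitBrackets X X X

namespace UnitBrackets

theorem comp {X : ι → ι → L} {Y Z : ι → ι → M} (h : UnitBrackets X Y Z) {g : κ → ι}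
    (hg : g.Injective) :
    UnitBrackets (fun i j => X (g i) (g j)) (fun i j => Y (g i) (g j))
      (fun i j => Z (g i) (g j)) := fun i j k l => by
  simp only [h (g i) (g j) (g k) (g l), hg.eq_iff]

theorem symm {X Y Z : ι → ι → L} (h : UnitBrackets X Y Z) : UnitBrackets Y X Z :=
  fun i j k l => by
  rw [← lie_skew, h k l i j, neg_sub]

theorem neg_right {X : ι → ι → L} {Y Z : ι → ι → M} (h : UnitBrackets X Y Z) :
    UnitBrackets X (fun i j => -Y i j) (fun i j => -Z i j) := fun i j k l => by
  rw [lie_neg, h]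
  grind

theorem neg_transpose {X : ι → ι → L} {Y Z : ι → ι → M} (h : UnitBrackets X Y Z) :
    UnitBrackets (fun i j => -X j i) (fun i j => Y j i) (fun i j => Z j i) := fun i j k l => by
  rw [neg_lie, h, neg_sub]
  simp only [eq_comm]

variable {X : ι → ι → L} {Y Y' : ι → ι → M}

theorem column_eq (hY : UnitBrackets X Y Y) (N i : ι) :
    Y i N = ⁅X i N, Y N N⁆ + if N = i then Y N N else 0 := by
  rw [hY, if_pos rfl, sub_add_cancel]

theorem eq_sub_lie (hY : UnitBrackets X Y Y) (N i j : ι) :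
    Y i j = (if j = i then Y N N else 0) - ⁅X N j, Y i N⁆ := by
  rw [hY, if_pos rfl, sub_sub_cancel]

theorem ext_of_apply_eq (hY : UnitBrackets X Y Y) (hY' : UnitBrackets X Y' Y') {N : ι}
    (h : Y N N = Y' N N) (i j : ι) : Y i j = Y' i j := by
  rw [hY.eq_sub_lie N, hY'.eq_sub_lie N, hY.column_eq N i, hY'.column_eq N i, h]

theorem lie_lie_eq_zero (hY : UnitBrackets X Y Y) {i j k l : ι} (hij : i ≠ j)
    (h : j ≠ k ∨ l ≠ i) : ⁅X i j, ⁅X i j, Y k l⁆⁆ = 0 := by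
  rw [hY i j k l, lie_sub]
  have hcol : ⁅X i j, Y i l⁆ = if l = i then -Y i j else 0 := by
    rw [hY, if_neg hij.symm, zero_sub, apply_ite Neg.neg, neg_zero]
  have hrow : ⁅X i j, Y k j⁆ = if j = k then Y i j else 0 := by
    rw [hY, if_neg hij.symm, sub_zero]
  grind [lie_zero, lie_neg]

end UnitBrackets

namespace IsMatrixUnits

theorem neg_transpose {X : ι → ι → L} (h : IsMatrixUnits X) :
    IsMatrixUnits fun i j => -X j i :=
  UnitBrackets.neg_right (UnitBrackets.neg_transpose h)

/-- Polarization of `⁅X p N, ⁅X p N, t⁆⁆ = 0` under the action of the `X i j` fixing `t`. -/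
theorem lie_column_lie_column_eq_zero [IsAddTorsionFree M] {X : ι → ι → L} (hX : IsMatrixUnits X)
    {N p : ι} {t : M} (ht : ∀ i j, i ≠ N → j ≠ N → ⁅X i j, t⁆ = 0) (hp : p ≠ N)
    (hpp : ⁅X p N, ⁅X p N, t⁆⁆ = 0) (i j : ι) (hi : i ≠ N) (hj : j ≠ N) :
    ⁅X i N, ⁅X j N, t⁆⁆ = 0 := by
  have act : ∀ k l i j, k ≠ N → l ≠ N → ⁅X k l, ⁅X i N, ⁅X j N, t⁆⁆⁆ =
      (if l = i then ⁅X k N, ⁅X j N, t⁆⁆ else 0) + if l = j then ⁅X i N, ⁅X k N, t⁆⁆ else 0 := by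
    intro k l i j hk hl
    rw [leibniz_lie, leibniz_lie (X k l) (X j N), ht k l hk hl, hX k l, hX k l]
    simp only [hk.symm, if_false, sub_zero, lie_zero, add_zero]
    split_ifs <;> simp
  have comm : ∀ i j, i ≠ N → j ≠ N → ⁅X i N, ⁅X j N, t⁆⁆ = ⁅X j N, ⁅X i N, t⁆⁆ := by
    intro i j hi hj
    rw [leibniz_lie, hX, if_neg hj.symm, if_neg hi.symm, sub_zero, zero_lie, zero_add]
  have hip : ∀ i, i ≠ N → ⁅X i N, ⁅X p N, t⁆⁆ = 0 := by
    intro i hi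
    have h := act i p p p hi hp
    rw [hpp, lie_zero, if_pos rfl, if_pos rfl, comm p i hp hi, ← two_nsmul] at h
    exact (smul_eq_zero_iff_right two_ne_zero).1 h.symm
  obtain rfl | hne := eq_or_ne i p
  · rw [comm i j hi hj, hip j hj]
  · have h := act j p i p hj hp
    rw [hip i hi, lie_zero, if_neg hne.symm, if_pos rfl, zero_add] at h
    exact h.symm

end IsMatrixUnits

/-- The `u k` transform under the `X i j` as the standard basis vectors do under the matrix
units. -/
def IsColumn (X : ι → ι → L) (u : ι → M) : Prop :=
  ∀ i j k, ⁅X i j, u k⁆ = if j = k then u i else 0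

theorem IsMatrixUnits.isColumn {X : ι → ι → L} (hX : IsMatrixUnits X) {N : ι} {e : M}
    (he : ∀ i j, j ≠ N → ⁅X i j, e⁆ = 0) (heN : ⁅X N N, e⁆ = e)
    (hq : ∀ i j, i ≠ N → j ≠ N → ⁅X i N, ⁅X j N, e⁆⁆ = 0) :
    IsColumn X fun k => ⁅X k N, e⁆ := by
  intro i j k
  rcases ne_or_eq j N with hj | rfl
  · rw [leibniz_lie, he i j hj, lie_zero, add_zero, hX, sub_lie]
    split_ifs <;> simp [he k j hj]
  · rcases eq_or_ne k j with rfl | hk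
    · simp only [heN, if_true]
    rw [if_neg hk.symm]
    rcases ne_or_eq i j with hi | rfl
    · exact hq i k hi hk
    · rw [leibniz_lie, heN, hX, if_neg hk.symm, if_pos rfl, zero_sub, neg_lie, neg_add_cancel]

theorem IsColumn.neg {X : ι → ι → L} {u : ι → M} (hu : IsColumn X u) :
    IsColumn X fun k => -u k := fun i j k => by
  rw [lie_neg, hu, apply_ite Neg.neg, neg_zero]

theorem IsColumn.lie_eq_zero {X : ι → ι → L} {u : ι → L} (hu : IsColumn X u) {p q : ι}
    (hpq : p ≠ q) (h : ⁅u p, u q⁆ = 0) (i k : ι) : ⁅u i, u k⁆ = 0 := by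
  have hq : ∀ i, ⁅u i, u q⁆ = 0 := fun i => by
    have := leibniz_lie (X i p) (u p) (u q)
    rwa [h, hu, hu, if_pos rfl, if_neg hpq, lie_zero, lie_zero, add_zero, eq_comm] at this
  have := leibniz_lie (X k q) (u i) (u q)
  have hk : ⁅if q = i then u k else 0, u q⁆ = 0 := by split_ifs <;> simp [hq k]
  rwa [hq i, hu, hu, if_pos rfl, lie_zero, hk, zero_add, eq_comm] at this

/-- The family `X` enlarged by the column `u`, the row `v` and the corner `D`, all indexed by
`none`. -/
def extendUnits (X : ι → ι → L) (u v : ι → L) (D : L) : Option ι → Option ι → L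
  | some i, some j => X i j
  | some i, none => u i
  | none, some j => v j
  | none, none => D

theorem IsMatrixUnits.lie_column_row {X : ι → ι → L} (hX : IsMatrixUnits X) {u v : ι → L}
    (hu : IsColumn X u) (hv : IsColumn (fun i j => -X j i) v) {D : L} (hD : ∀ i j, ⁅X i j, D⁆ = 0)
    {N : ι} (huv : ⁅u N, v N⁆ = X N N - D) (i j : ι) :
    ⁅u i, v j⁆ = X i j - if i = j then D else 0 := by
  have hv' : ∀ i j k, ⁅X i j, v k⁆ = -if k = i then v j else 0 := fun i j k => by
    rw [← neg_neg (X i j), neg_lie, hv j i k]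
    simp only [eq_comm]
  have hY : UnitBrackets X (fun i j => ⁅u i, v j⁆ + if i = j then D else 0)
      fun i j => ⁅u i, v j⁆ + if i = j then D else 0 := by
    intro i j k l
    have hD' : ⁅X i j, if k = l then D else 0⁆ = 0 := by split_ifs <;> simp [hD]
    rw [lie_add, leibniz_lie, hu, hv', hD', add_zero]
    grind [zero_lie, lie_zero, lie_neg]
  exact eq_sub_of_add_eq (hY.ext_of_apply_eq hX (N := N) (by simp [huv]) i j)

theorem IsMatrixUnits.extendUnits {X : ι → ι → L} (hX : IsMatrixUnits X) {u v : ι → L}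
    (hu : IsColumn X u) (hv : IsColumn (fun i j => -X j i) v) (huu : ∀ i j, ⁅u i, u j⁆ = 0)
    (hvv : ∀ i j, ⁅v i, v j⁆ = 0) {D : L} (hD : ∀ i j, ⁅X i j, D⁆ = 0) {N : ι}
    (hDu : ⁅D, u N⁆ = -u N) (hDv : ⁅D, v N⁆ = v N) (huv : ⁅u N, v N⁆ = X N N - D) :
    IsMatrixUnits (extendUnits X u v D) := by
  have huv' := hX.lie_column_row hu hv hD huv
  have hvX : ∀ i j k, ⁅v k, X i j⁆ = if i = k then v j else 0 := fun i j k => by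
    rw [← lie_skew, ← neg_lie, hv j i k]
  have huX : ∀ i j k, ⁅u k, X i j⁆ = -if j = k then u i else 0 := fun i j k => by
    rw [← lie_skew, hu]
  have hXv : ∀ i j k, ⁅X i j, v k⁆ = -if i = k then v j else 0 := fun i j k => by
    rw [← lie_skew, hvX]
  have hvu : ∀ i j, ⁅v i, u j⁆ = (if j = i then D else 0) - X j i := fun i j => by
    rw [← lie_skew, huv', neg_sub]
  have hDX : ∀ i j, ⁅D, X i j⁆ = 0 := fun i j => by rw [← lie_skew, hD, neg_zero]
  have hDu' : ∀ k, ⁅D, u k⁆ = -u k := fun k => by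
    have h : u k = ⁅X k N, u N⁆ := by rw [hu, if_pos rfl]
    rw [h, leibniz_lie, hDX, zero_lie, zero_add, hDu, lie_neg]
  have hDv' : ∀ k, ⁅D, v k⁆ = v k := fun k => by
    have h : v k = ⁅v N, X N k⁆ := by rw [hvX, if_pos rfl]
    rw [h, leibniz_lie, hDX, lie_zero, add_zero, hDv]
  have huD : ∀ k, ⁅u k, D⁆ = u k := fun k => by rw [← lie_skew, hDu', neg_neg]
  have hvD : ∀ k, ⁅v k, D⁆ = -v k := fun k => by rw [← lie_skew, hDv']
  rintro (_ | i) (_ | j) (_ | k) (_ | l)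
  case some.some.some.some =>
    simpa only [EvenFixedPoint.extendUnits, Option.some_inj] using hX i j k l
  all_goals simp [EvenFixedPoint.extendUnits, hu _ _ _, huX, hXv, hvX, huu, hvv, hD, hDX, hDu',
    hDv', huD, hvD, huv', hvu, eq_comm]

end UnitBrackets

section Chevalley

variable {L : Type*} [LieRing L] {n : ℕ}

/-- The Serre relations of `gl_{n+1}` for the Chevalley generators `E i i`, `E i (i + 1)` and
`E (i + 1) i`, except that the `d i` commute, which is `IsChevalley.d_d`. -/
structure IsChevalley (d : Fin (n + 1) → L) (e f : Fin n → L) : Prop where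
  d_e : ∀ i j, ⁅d i, e j⁆ = (if i = j.castSucc then e j else 0) - if i = j.succ then e j else 0
  d_f : ∀ i j, ⁅d i, f j⁆ = (if i = j.succ then f j else 0) - if i = j.castSucc then f j else 0
  e_f : ∀ i j, ⁅e i, f j⁆ = if i = j then d i.castSucc - d i.succ else 0
  e_e : ∀ i j : Fin n, (i : ℕ) + 1 < j → ⁅e i, e j⁆ = 0
  f_f : ∀ i j : Fin n, (i : ℕ) + 1 < j → ⁅f i, f j⁆ = 0
  serre_e : ∀ i j : Fin n, (i : ℕ) + 1 = j ∨ (j : ℕ) + 1 = i → ⁅e i, ⁅e i, e j⁆⁆ = 0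
  serre_f : ∀ i j : Fin n, (i : ℕ) + 1 = j ∨ (j : ℕ) + 1 = i → ⁅f i, ⁅f i, f j⁆⁆ = 0

namespace IsChevalley

theorem dual {d : Fin (n + 1) → L} {e f : Fin n → L} (h : IsChevalley d e f) :
    IsChevalley (fun i => -d i) (fun i => -f i) (fun i => -e i) where
  d_e i j := by simp only [neg_lie, lie_neg, neg_neg, h.d_f]; grind
  d_f i j := by simp only [neg_lie, lie_neg, neg_neg, h.d_e]; grind
  e_f i j := by rw [neg_lie, lie_neg, neg_neg, ← lie_skew, h.e_f]; grind
  e_e i j hij := by rw [neg_lie, lie_neg, neg_neg, h.f_f i j hij]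
  f_f i j hij := by rw [neg_lie, lie_neg, neg_neg, h.e_e i j hij]
  serre_e i j hij := by simp only [neg_lie, lie_neg, neg_neg, h.serre_f i j hij, neg_zero]
  serre_f i j hij := by simp only [neg_lie, lie_neg, neg_neg, h.serre_e i j hij, neg_zero]

theorem castSucc {d : Fin (n + 2) → L} {e f : Fin (n + 1) → L} (h : IsChevalley d e f) :
    IsChevalley (fun i => d i.castSucc) (fun i => e i.castSucc) (fun i => f i.castSucc) where
  d_e i j := by simp only [h.d_e, Fin.succ_castSucc, Fin.castSucc_inj]
  d_f i j := by simp only [h.d_f, Fin.succ_castSucc, Fin.castSucc_inj]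
  e_f i j := by simp only [h.e_f, Fin.succ_castSucc, Fin.castSucc_inj]
  e_e i j := h.e_e i.castSucc j.castSucc
  f_f i j := h.f_f i.castSucc j.castSucc
  serre_e i j := h.serre_e i.castSucc j.castSucc
  serre_f i j := h.serre_f i.castSucc j.castSucc

theorem d_d {d : Fin (n + 1) → L} {e f : Fin n → L} (h : IsChevalley d e f) (i j : Fin (n + 1)) :
    ⁅d i, d j⁆ = 0 := by
  have lie_castSucc : ∀ k : Fin n, ⁅d i, d k.castSucc⁆ = ⁅d i, d k.succ⁆ := fun k => by
    have hk := leibniz_lie (d i) (e k) (f k)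
    rw [h.e_f, if_pos rfl, h.d_e, h.d_f, lie_sub] at hk
    have hef : ⁅f k, e k⁆ + ⁅e k, f k⁆ = 0 := by rw [← lie_skew, neg_add_cancel]
    rw [← sub_eq_zero, hk]
    split_ifs <;> simp [hef, add_comm ⁅e k, f k⁆]
  have lie_zero_index : ∀ k, ⁅d i, d k⁆ = ⁅d i, d 0⁆ := fun k => by
    induction k using Fin.induction with
    | zero => rfl
    | succ k ih => rw [← lie_castSucc, ih]
  rw [lie_zero_index j, ← lie_zero_index i, lie_self]

end IsChevalley

/-- Matrix units `X` among which `d`, `e` and `f` are the diagonal, the superdiagonal and the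
subdiagonal. -/
structure IsChevalleyUnits (X : Fin (n + 1) → Fin (n + 1) → L) (d : Fin (n + 1) → L)
    (e f : Fin n → L) : Prop where
  units : IsMatrixUnits X
  diag : ∀ i, X i i = d i
  upper : ∀ i : Fin n, X i.castSucc i.succ = e i
  lower : ∀ i : Fin n, X i.succ i.castSucc = f i

namespace IsChevalleyUnits

variable {X : Fin (n + 1) → Fin (n + 1) → L} {d : Fin (n + 1) → L} {e f : Fin n → L}

theorem dual (hX : IsChevalleyUnits X d e f) :
    IsChevalleyUnits (fun i j => -X j i) (fun i => -d i) (fun i => -f i) (fun i => -e i) where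
  units := hX.units.neg_transpose
  diag i := by rw [hX.diag]
  upper i := by rw [hX.lower]
  lower i := by rw [hX.upper]

theorem isChevalley (hX : IsChevalleyUnits X d e f) : IsChevalley d e f := by
  have hlt : ∀ i : Fin n, i.castSucc < i.succ := fun i => Fin.castSucc_lt_succ
  constructor <;> intro i j <;> simp only [← hX.diag, ← hX.upper, ← hX.lower]
  case serre_e => exact fun _ => hX.units.lie_lie_eq_zero (hlt i).ne (by grind)
  case serre_f => exact fun _ => hX.units.lie_lie_eq_zero (hlt i).ne' (by grind)
  all_goals rw [hX.units _ _ _ _]; grind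

theorem lie_induction_of_lt (hX : IsChevalleyUnits X d e f) {p : L → Prop}
    (hp : ∀ x y, p x → p y → p ⁅x, y⁆) {i j : Fin (n + 1)} (hij : i < j)
    (he : ∀ k : Fin n, i ≤ k.castSucc → k.succ ≤ j → p (e k)) : p (X i j) := by
  induction j using Fin.induction with
  | zero => exact absurd hij (Fin.not_lt_zero i)
  | succ j ih =>
    have hj : p (X j.castSucc j.succ) := by
      rw [hX.upper]
      exact he j (Fin.le_castSucc_iff.2 hij) le_rfl
    rcases (Fin.le_castSucc_iff.2 hij).eq_or_lt with rfl | hlt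
    · exact hj
    have hcomp := hp _ _ (ih hlt fun k hk hkj =>
      he k hk (hkj.trans (Fin.castSucc_le_succ j))) hj
    rwa [hX.units, if_pos rfl, if_neg hij.ne', sub_zero] at hcomp

theorem lie_induction (hX : IsChevalleyUnits X d e f) {p : L → Prop}
    (hp : ∀ x y, p x → p y → p ⁅x, y⁆) {i j : Fin (n + 1)} (hd : i = j → p (d i))
    (he : ∀ k : Fin n, i ≤ k.castSucc → k.succ ≤ j → p (e k))
    (hf : ∀ k : Fin n, j ≤ k.castSucc → k.succ ≤ i → p (f k)) : p (X i j) := by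
  rcases lt_trichotomy i j with hij | rfl | hij
  · exact hX.lie_induction_of_lt hp hij he
  · exact hX.diag i ▸ hd rfl
  · have := hX.dual.lie_induction_of_lt (p := fun x => p (-x))
      (fun x y hx hy => by simpa using hp _ _ hy hx) hij fun k hk hki => by
        simpa using hf k hk hki
    simpa using this

theorem lie_eq_zero {M : Type*} [AddCommGroup M] [LieRingModule L M]
    (hX : IsChevalleyUnits X d e f) {z : M} {i j : Fin (n + 1)} (hd : i = j → ⁅d i, z⁆ = 0)
    (he : ∀ k : Fin n, k.succ ≤ j → ⁅e k, z⁆ = 0)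
    (hf : ∀ k : Fin n, j ≤ k.castSucc → k.succ ≤ i → ⁅f k, z⁆ = 0) : ⁅X i j, z⁆ = 0 :=
  hX.lie_induction (p := fun x => ⁅x, z⁆ = 0)
    (fun x y hx hy => by rw [lie_lie, hx, hy, lie_zero, lie_zero, sub_zero])
    hd (fun k _ => he k) hf

end IsChevalleyUnits

section Extension

variable {X : Fin (n + 1) → Fin (n + 1) → L} {d : Fin (n + 2) → L} {e f : Fin (n + 1) → L}

theorem IsChevalley.exists_isColumn [IsAddTorsionFree L] (h : IsChevalley d e f)
    (hX : IsChevalleyUnits X (fun i => d i.castSucc) (fun i => e i.castSucc)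
      fun i => f i.castSucc) :
    ∃ u, IsColumn X u ∧ u (Fin.last n) = e (Fin.last n) ∧ ∀ i j, ⁅u i, u j⁆ = 0 := by
  have hlast : ⁅X (Fin.last n) (Fin.last n), e (Fin.last n)⁆ = e (Fin.last n) := by
    rw [hX.diag, h.d_e, if_pos rfl, if_neg (Fin.castSucc_lt_succ.ne), sub_zero]
  have hzero : ∀ i j, j ≠ Fin.last n → ⁅X i j, e (Fin.last n)⁆ = 0 := by
    intro i j hj
    refine hX.lie_eq_zero (fun hij => ?_) (fun k hk => ?_) fun k _ _ => ?_
    · subst hij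
      rw [h.d_e, if_neg (by simpa using hj), if_neg (by grind), sub_zero]
    · exact h.e_e _ _ (by grind)
    · rw [← lie_skew, h.e_f, if_neg (Fin.castSucc_lt_last k).ne', neg_zero]
  rcases n with _ | n
  · refine ⟨_, hX.units.isColumn hzero hlast fun i _ hi => ?_, hlast, fun i j => ?_⟩
    · exact absurd (Subsingleton.elim (α := Fin 1) i _) hi
    · rw [Subsingleton.elim (α := Fin 1) i j, lie_self]
  have hpre : X (Fin.last n).castSucc (Fin.last (n + 1)) = e (Fin.last n).castSucc :=
    hX.upper (Fin.last n)
  have hne : (Fin.last n).castSucc ≠ Fin.last (n + 1) := Fin.castSucc_ne_last _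
  have hquad := hX.units.lie_column_lie_column_eq_zero (t := e (Fin.last (n + 1)))
    (fun i j _ => hzero i j) hne
    (by rw [hpre]; exact h.serre_e _ _ (by simp))
  have hu := hX.units.isColumn hzero hlast hquad
  refine ⟨_, hu, hlast, hu.lie_eq_zero hne ?_⟩
  rw [hpre, hlast, ← lie_skew, ← lie_skew _ (e _), lie_neg, neg_neg,
    h.serre_e _ _ (by simp)]

theorem IsChevalley.exists_extension [IsAddTorsionFree L] (h : IsChevalley d e f)
    (hX : IsChevalleyUnits X (fun i => d i.castSucc) (fun i => e i.castSucc)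
      fun i => f i.castSucc) : ∃ X', IsChevalleyUnits X' d e f := by
  obtain ⟨u, hu, hue, huu⟩ := h.exists_isColumn hX
  obtain ⟨v, hv, hvf, hvv⟩ := h.dual.exists_isColumn hX.dual
  have hd : ∀ i j, ⁅X i j, d (Fin.last _)⁆ = 0 := by
    refine fun i j => hX.lie_eq_zero (fun _ => h.d_d _ _) (fun k _ => ?_) fun k _ _ => ?_
    · rw [← lie_skew, h.d_e, if_neg (by grind),
        if_neg (by grind), sub_zero, neg_zero]
    · rw [← lie_skew, h.d_f, if_neg (by grind),
        if_neg (by grind), sub_zero, neg_zero]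
  have hX' : IsMatrixUnits (extendUnits X u (fun k => -v k) (d (Fin.last _))) := by
    refine hX.units.extendUnits hu hv.neg huu (by simpa using hvv) hd (N := Fin.last n) ?_ ?_ ?_
    · rw [hue, ← Fin.succ_last, h.d_e, if_neg Fin.castSucc_lt_succ.ne', if_pos rfl, zero_sub]
    · rw [hvf, neg_neg, ← Fin.succ_last, h.d_f, if_pos rfl, if_neg Fin.castSucc_lt_succ.ne',
        sub_zero]
    · rw [hue, hvf, neg_neg, h.e_f, if_pos rfl, hX.diag, Fin.succ_last]
  refine ⟨_, hX'.comp finSuccEquivLast.injective, ?_, ?_, ?_⟩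
  all_goals intro i; induction i using Fin.lastCases
  all_goals simp only [Fin.succ_castSucc, Fin.succ_last, finSuccEquivLast_castSucc,
    finSuccEquivLast_last, extendUnits, hX.diag, hX.upper, hX.lower, hue, hvf, neg_neg]

end Extension

theorem IsChevalley.exists_isChevalleyUnits [IsAddTorsionFree L] {d : Fin (n + 1) → L}
    {e f : Fin n → L} (h : IsChevalley d e f) : ∃ X, IsChevalleyUnits X d e f := by
  induction n with
  | zero =>
    refine ⟨fun _ _ => d 0, fun i j k l => ?_, fun i => ?_, fun i => i.elim0, fun i => i.elim0⟩
    · rw [lie_self, if_pos (Subsingleton.elim (α := Fin 1) _ _),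
        if_pos (Subsingleton.elim (α := Fin 1) _ _), sub_self]
    · rw [Subsingleton.elim (α := Fin 1) i 0]
  | succ n ih =>
    obtain ⟨X, hX⟩ := ih h.castSucc
    exact h.exists_extension hX

end Chevalley

section CornerUnit

variable {L M ι : Type*} [LieRing L] [AddCommGroup M] [LieRingModule L M] [DecidableEq ι]

/-- The brackets of degree at most two by which `t` behaves under the `X i j` as the matrix unit
`E N N` does. -/
structure IsCornerUnit (X : ι → ι → L) (N : ι) (t : M) : Prop where
  lie_corner : ⁅X N N, t⁆ = 0
  lie_block : ∀ i j, i ≠ N → j ≠ N → ⁅X i j, t⁆ = 0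
  lie_column_column : ∀ i j, i ≠ N → j ≠ N → ⁅X i N, ⁅X j N, t⁆⁆ = 0
  lie_row_row : ∀ i j, i ≠ N → j ≠ N → ⁅X N i, ⁅X N j, t⁆⁆ = 0

/-- The `N`-th column of the family of matrix units generated by `t` in position `(N, N)`. -/
def orbitColumn (X : ι → ι → L) (N : ι) (t : M) (i : ι) : M :=
  ⁅X i N, t⁆ + if i = N then t else 0

/-- The family of matrix units generated by `t` in position `(N, N)` under the action of the
`X i j`; see `UnitBrackets.column_eq` and `UnitBrackets.eq_sub_lie` for the formulas. -/
def orbitUnits (X : ι → ι → L) (N : ι) (t : M) (i j : ι) : M :=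
  (if i = j then t else 0) - ⁅X N j, orbitColumn X N t i⁆

namespace IsCornerUnit

variable {X : ι → ι → L} {N : ι} {t : M}

theorem orbitColumn_self (ht : IsCornerUnit X N t) : orbitColumn X N t N = t := by
  rw [orbitColumn, ht.lie_corner, if_pos rfl, zero_add]

theorem orbitUnits_self (ht : IsCornerUnit X N t) : orbitUnits X N t N N = t := by
  rw [orbitUnits, ht.orbitColumn_self, ht.lie_corner, if_pos rfl, sub_zero]

theorem orbitUnits_row (ht : IsCornerUnit X N t) {j : ι} (hj : j ≠ N) :
    orbitUnits X N t N j = -⁅X N j, t⁆ := by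
  rw [orbitUnits, ht.orbitColumn_self, if_neg hj.symm, zero_sub]

theorem orbitUnits_column (ht : IsCornerUnit X N t) (hX : IsMatrixUnits X) (i : ι) :
    orbitUnits X N t i N = orbitColumn X N t i := by
  obtain rfl | hi := eq_or_ne i N
  · rw [ht.orbitUnits_self, ht.orbitColumn_self]
  · rw [orbitUnits, orbitColumn, if_neg hi, add_zero, leibniz_lie, ht.lie_corner, lie_zero,
      add_zero, hX, if_neg hi.symm, if_pos rfl, zero_sub, zero_sub, neg_lie, neg_neg]

theorem lie_orbitColumn (ht : IsCornerUnit X N t) (hX : IsMatrixUnits X) (i j k : ι) :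
    ⁅X i j, orbitColumn X N t k⁆ =
      (if j = k then orbitColumn X N t i else 0) - if i = N then orbitUnits X N t k j else 0 := by
  obtain rfl | hi := eq_or_ne i N
  · rw [if_pos rfl, orbitUnits, ht.orbitColumn_self]
    simp only [eq_comm, sub_sub_cancel]
  rw [if_neg hi, sub_zero]
  obtain rfl | hk := eq_or_ne k N
  · rw [ht.orbitColumn_self]
    obtain rfl | hj := eq_or_ne j k
    · rw [if_pos rfl, orbitColumn, if_neg hi, add_zero]
    · rw [if_neg hj, ht.lie_block i j hi hj]
  rw [orbitColumn, orbitColumn, if_neg hi, if_neg hk, add_zero, add_zero]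
  obtain rfl | hj := eq_or_ne j N
  · rw [if_neg hk.symm, ht.lie_column_column i k hi hk]
  · rw [leibniz_lie, ht.lie_block i j hi hj, lie_zero, add_zero, hX, if_neg hi.symm, sub_zero]
    split_ifs <;> simp

theorem lie_row_orbitUnits_row (ht : IsCornerUnit X N t) (hX : IsMatrixUnits X) (j : ι) {l : ι}
    (hl : l ≠ N) :
    ⁅X N j, orbitUnits X N t N l⁆ = if j = N then orbitUnits X N t N l else 0 := by
  rw [ht.orbitUnits_row hl, lie_neg]
  obtain rfl | hj := eq_or_ne j N
  · rw [leibniz_lie, ht.lie_corner, hX, if_pos rfl, if_pos rfl, if_neg hl, sub_zero, lie_zero,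
      add_zero]
  · rw [if_neg hj, ht.lie_row_row j l hj hl, neg_zero]

theorem orbitUnits_of_ne (ht : IsCornerUnit X N t) (hX : IsMatrixUnits X) {i l : ι} (hi : i ≠ N)
    (hl : l ≠ N) :
    orbitUnits X N t i l = (if i = l then t else 0) + ⁅X i N, orbitUnits X N t N l⁆ := by
  have hcomm : ⁅⁅X N l, X i N⁆, t⁆ = 0 := by
    rw [hX, if_pos rfl, sub_lie, ht.lie_block i l hi hl, sub_zero]
    split_ifs <;> simp [ht.lie_corner]
  rw [orbitUnits, orbitColumn, if_neg hi, add_zero, leibniz_lie, hcomm, zero_add,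
    ht.orbitUnits_row hl, lie_neg, sub_eq_add_neg]

theorem lie_row_orbitUnits (ht : IsCornerUnit X N t) (hX : IsMatrixUnits X) (i j l : ι) :
    ⁅X N j, orbitUnits X N t i l⁆ =
      (if j = i then orbitUnits X N t N l else 0) - if l = N then orbitUnits X N t i j else 0 := by
  obtain rfl | hl := eq_or_ne l N
  · rw [ht.orbitUnits_column hX, ht.lie_orbitColumn hX, ht.orbitUnits_self, ht.orbitColumn_self]
  rw [if_neg hl, sub_zero]
  obtain rfl | hi := eq_or_ne i N
  · rw [ht.lie_row_orbitUnits_row hX j hl]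
  have hij : ⁅X i j, orbitUnits X N t N l⁆ =
      (if j = N then ⁅X i N, orbitUnits X N t N l⁆ else 0) +
        if i = l then ⁅X N j, t⁆ else 0 := by
    obtain rfl | hj := eq_or_ne j N
    · simp [ht.lie_corner]
    · rw [ht.orbitUnits_row hl, lie_neg, leibniz_lie, ht.lie_block i j hi hj, hX, if_neg hj,
        if_neg hj]
      obtain rfl | hil := eq_or_ne i l
      · simp
      · simp [hil, hil.symm]
  have ht_ite : ⁅X N j, if i = l then t else 0⁆ = if i = l then ⁅X N j, t⁆ else 0 := by
    split_ifs <;> simp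
  have hdiag : ⁅if j = i then X N N else 0, orbitUnits X N t N l⁆ =
      if j = i then orbitUnits X N t N l else 0 := by
    split_ifs <;> simp [ht.lie_row_orbitUnits_row hX N hl]
  have hcol : ⁅X i N, if j = N then orbitUnits X N t N l else 0⁆ =
      if j = N then ⁅X i N, orbitUnits X N t N l⁆ else 0 := by
    split_ifs <;> simp
  rw [ht.orbitUnits_of_ne hX hi hl, lie_add, leibniz_lie, hX, if_pos rfl, sub_lie,
    ht.lie_row_orbitUnits_row hX j hl, ht_ite, hdiag, hcol, hij]
  abel

theorem unitBrackets (ht : IsCornerUnit X N t) (hX : IsMatrixUnits X) :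
    UnitBrackets X (orbitUnits X N t) (orbitUnits X N t) := by
  intro k l i j
  have hlie_t : ⁅X k l, t⁆ =
      (if l = N then orbitColumn X N t k else 0) - if k = N then orbitUnits X N t N l else 0 := by
    rw [← ht.lie_orbitColumn hX, ht.orbitColumn_self]
  have hbr : ⁅X k l, ⁅X N j, orbitColumn X N t i⁆⁆ =
      (if l = N then ⁅X k j, orbitColumn X N t i⁆ else 0) -
        (if j = k then ⁅X N l, orbitColumn X N t i⁆ else 0) +
      ((if l = i then ⁅X N j, orbitColumn X N t k⁆ else 0) -
        if k = N then ⁅X N j, orbitUnits X N t i l⁆ else 0) := by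
    rw [leibniz_lie, hX, ht.lie_orbitColumn hX k l i, sub_lie, lie_sub]
    split_ifs <;> simp
  have ht_ite : ⁅X k l, if i = j then t else 0⁆ = if i = j then ⁅X k l, t⁆ else 0 := by
    split_ifs <;> simp
  rw [orbitUnits, lie_sub, hbr, ht_ite, hlie_t]
  simp only [ht.lie_orbitColumn hX, ht.lie_row_orbitUnits hX, ht.orbitColumn_self, if_true]
  grind

end IsCornerUnit

end CornerUnit

section DoubledUnits

variable {L ι : Type*} [LieRing L] [DecidableEq ι]

/-- Two families with the commutation relations of `E i j` and `ε E i j` in `gl ⊗ ℤ[ε]`, where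
`ε² = 1`. -/
structure IsDoubledUnits (X B : ι → ι → L) : Prop where
  units : IsMatrixUnits X
  mixed : UnitBrackets X B B
  twisted : UnitBrackets B B X

/-- The two ways of writing `B k l` as a bracket with a row or a column of `X` evaluate
`⁅B N N, B k l⁆`, for `k` and `l` different from `N`, to opposite values. -/
theorem UnitBrackets.lie_corner_eq [IsAddTorsionFree L] {X B : ι → ι → L} {N : ι}
    (hX : IsMatrixUnits X) (hB : UnitBrackets X B B)
    (hcol : ∀ i, i ≠ N → ⁅B N N, ⁅B N N, X i N⁆⁆ = X i N)
    (hrow : ∀ i, i ≠ N → ⁅B N N, ⁅B N N, X N i⁆⁆ = X N i) (k l : ι) :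
    ⁅B N N, B k l⁆ = ⁅X N N, X k l⁆ := by
  have corner_column : ∀ i, i ≠ N → ⁅B N N, X i N⁆ = -B i N := fun i hi => by
    rw [← lie_skew, hB, if_pos rfl, if_neg hi.symm, sub_zero]
  have corner_row : ∀ i, i ≠ N → ⁅B N N, X N i⁆ = B N i := fun i hi => by
    rw [← lie_skew, hB, if_pos rfl, if_neg hi, zero_sub, neg_neg]
  have column : ∀ i, i ≠ N → ⁅B N N, B i N⁆ = -X i N := fun i hi => by
    rw [← hcol i hi, corner_column i hi, lie_neg, neg_neg]
  have row : ∀ i, i ≠ N → ⁅B N N, B N i⁆ = X N i := fun i hi => by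
    rw [← hrow i hi, corner_row i hi]
  rw [hX]
  obtain rfl | hk := eq_or_ne N k
  · obtain rfl | hl := eq_or_ne l N
    · simp
    · simp [row l hl, hl]
  obtain rfl | hl := eq_or_ne l N
  · simp [column k hk.symm, hk]
  rw [if_neg hk, if_neg hl, sub_zero]
  have corner_diag : ⁅B N N, if l = k then B N N else 0⁆ = 0 := by split_ifs <;> simp
  have via_row : ⁅B N N, B k l⁆ = ⁅B k N, B N l⁆ - ⁅X k N, X N l⁆ := by
    rw [hB.eq_sub_lie N k l, lie_sub, corner_diag, leibniz_lie, corner_row l hl, column k hk.symm,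
      lie_neg, zero_sub, neg_add, neg_neg, lie_skew, ← lie_skew (X N l), sub_eq_add_neg]
  have via_column : ⁅B N N, B k l⁆ = ⁅X k N, X N l⁆ - ⁅B k N, B N l⁆ := by
    have hkl : B k l = ⁅X k N, B N l⁆ + if l = k then B N N else 0 := by
      rw [hB, if_pos rfl, sub_add_cancel]
    rw [hkl, lie_add, corner_diag, add_zero, leibniz_lie, corner_column k hk.symm, row l hl,
      neg_lie, neg_add_eq_sub]
  have two_smul_eq_zero : (2 : ℕ) • ⁅B N N, B k l⁆ = 0 := by
    rw [two_nsmul]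
    nth_rewrite 1 [via_row]
    rw [via_column, sub_add_sub_cancel, sub_self]
  exact (smul_eq_zero_iff_right two_ne_zero).1 two_smul_eq_zero

theorem IsMatrixUnits.isDoubledUnits {X B : ι → ι → L} {N : ι} (hX : IsMatrixUnits X)
    (hB : UnitBrackets X B B) (hN : ∀ k l, ⁅B N N, B k l⁆ = ⁅X N N, X k l⁆) :
    IsDoubledUnits X B := by
  have hlie : ∀ a b i j, (∀ k l, ⁅B i j, B k l⁆ = ⁅X i j, X k l⁆) →
      ∀ k l, ⁅⁅X a b, B i j⁆, B k l⁆ = ⁅⁅X a b, X i j⁆, X k l⁆ := by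
    intro a b i j h k l
    rw [lie_lie, lie_lie, h, hB, hX a b k l]
    grind [lie_zero, lie_sub]
  have hdiag : ∀ (P : Prop) [Decidable P] k l, ⁅if P then B N N else 0, B k l⁆ =
      ⁅if P then X N N else 0, X k l⁆ := by
    intro P _ k l
    split_ifs <;> simp [hN]
  have hcol : ∀ i k l, ⁅B i N, B k l⁆ = ⁅X i N, X k l⁆ := fun i k l => by
    rw [hX.column_eq N i, hB.column_eq N i, add_lie, add_lie, hlie i N N N hN, hdiag]
  refine ⟨hX, hB, fun i j k l => ?_⟩
  rw [hB.eq_sub_lie N i j, sub_lie, hlie _ _ _ _ (hcol i), hdiag, ← sub_lie,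
    ← hX.eq_sub_lie N i j, hX]

end DoubledUnits

section IChevalley

variable {L : Type*} [LieRing L] {n : ℕ}

/-- The relations (R1)–(R4) of the presentation, written with Lie brackets. They say that `t` lies
in the position of `ε E n n` relative to the Chevalley generators of `gl_{n+1}`. -/
structure IsIChevalley (d : Fin (n + 1) → L) (e f : Fin n → L) (t : L) : Prop
    extends IsChevalley d e f where
  t_d : ∀ i, ⁅t, d i⁆ = 0
  t_e : ∀ i : Fin n, (i : ℕ) + 1 < n → ⁅t, e i⁆ = 0
  t_f : ∀ i : Fin n, (i : ℕ) + 1 < n → ⁅t, f i⁆ = 0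
  e_e_t : ∀ i : Fin n, (i : ℕ) + 1 = n → ⁅e i, ⁅e i, t⁆⁆ = 0
  f_f_t : ∀ i : Fin n, (i : ℕ) + 1 = n → ⁅f i, ⁅f i, t⁆⁆ = 0
  t_t_e : ∀ i : Fin n, (i : ℕ) + 1 = n → ⁅t, ⁅t, e i⁆⁆ = e i
  t_t_f : ∀ i : Fin n, (i : ℕ) + 1 = n → ⁅t, ⁅t, f i⁆⁆ = f i

variable {X B : Fin (n + 1) → Fin (n + 1) → L} {d : Fin (n + 1) → L} {e f : Fin n → L} {t : L}

namespace IsIChevalley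

theorem lie_block (h : IsIChevalley d e f t) (hX : IsChevalleyUnits X d e f) (i j : Fin (n + 1))
    (hi : i ≠ Fin.last n) (hj : j ≠ Fin.last n) : ⁅X i j, t⁆ = 0 := by
  have hlt : ∀ {k : Fin n} {l : Fin (n + 1)}, l ≠ Fin.last n → k.succ ≤ l → (k : ℕ) + 1 < n := by
    intro k l hl hk
    simpa using (Fin.lt_def.1 (hk.trans_lt (Fin.lt_last_iff_ne_last.2 hl)))
  refine hX.lie_eq_zero (fun _ => ?_) (fun k hk => ?_) fun k _ hk => ?_
  · rw [← lie_skew, h.t_d, neg_zero]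
  · rw [← lie_skew, h.t_e k (hlt hj hk), neg_zero]
  · rw [← lie_skew, h.t_f k (hlt hi hk), neg_zero]

theorem isCornerUnit [IsAddTorsionFree L] (h : IsIChevalley d e f t)
    (hX : IsChevalleyUnits X d e f) : IsCornerUnit X (Fin.last n) t := by
  have hblock := h.lie_block hX
  have hcorner : ⁅X (Fin.last n) (Fin.last n), t⁆ = 0 := by
    rw [hX.diag, ← lie_skew, h.t_d, neg_zero]
  rcases n with _ | n
  · have hne : ∀ i : Fin 1, ¬i ≠ Fin.last 0 := fun i hi => hi (Subsingleton.elim i _)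
    exact ⟨hcorner, hblock, fun i _ hi => absurd hi (hne i), fun i _ hi => absurd hi (hne i)⟩
  have hne : (Fin.last n).castSucc ≠ Fin.last (n + 1) := Fin.castSucc_ne_last _
  have hupper := hX.upper (Fin.last n)
  have hlower := hX.lower (Fin.last n)
  rw [Fin.succ_last] at hupper hlower
  refine ⟨hcorner, hblock, hX.units.lie_column_lie_column_eq_zero hblock hne ?_, ?_⟩
  · rw [hupper, h.e_e_t _ (by simp)]
  · have := hX.units.neg_transpose.lie_column_lie_column_eq_zero (t := t)
      (fun i j hi hj => by rw [neg_lie, hblock j i hj hi, neg_zero]) hne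
      (by rw [hlower, neg_lie, neg_lie, lie_neg, neg_neg, h.f_f_t _ (by simp)])
    simpa only [neg_lie, lie_neg, neg_neg] using this

theorem lie_lie_column (h : IsIChevalley d e f t) (hX : IsChevalleyUnits X d e f)
    (i : Fin (n + 1)) (hi : i ≠ Fin.last n) : ⁅t, ⁅t, X i (Fin.last n)⁆⁆ = X i (Fin.last n) := by
  have hblock := h.lie_block hX
  rcases n with _ | n
  · exact absurd (Subsingleton.elim (α := Fin 1) i _) hi
  have hne : (Fin.last n).castSucc ≠ Fin.last (n + 1) := Fin.castSucc_ne_last _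
  have hti : ⁅t, X i (Fin.last n).castSucc⁆ = 0 := by
    rw [← lie_skew, hblock i _ hi hne, neg_zero]
  have hfactor : X i (Fin.last (n + 1)) = ⁅X i (Fin.last n).castSucc, e (Fin.last n)⁆ := by
    rw [← hX.upper, hX.units, if_pos rfl, Fin.succ_last, if_neg hi.symm, sub_zero]
  rw [hfactor, leibniz_lie t (X i _), hti, zero_lie, zero_add, leibniz_lie t (X i _), hti, zero_lie,
    zero_add, h.t_t_e _ (by simp)]

theorem dual (h : IsIChevalley d e f t) :
    IsIChevalley (fun i => -d i) (fun i => -f i) (fun i => -e i) t where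
  toIsChevalley := h.toIsChevalley.dual
  t_d i := by rw [lie_neg, h.t_d, neg_zero]
  t_e i hi := by rw [lie_neg, h.t_f i hi, neg_zero]
  t_f i hi := by rw [lie_neg, h.t_e i hi, neg_zero]
  e_e_t i hi := by rw [neg_lie, neg_lie, lie_neg, neg_neg, h.f_f_t i hi]
  f_f_t i hi := by rw [neg_lie, neg_lie, lie_neg, neg_neg, h.e_e_t i hi]
  t_t_e i hi := by rw [lie_neg, lie_neg, h.t_t_f i hi]
  t_t_f i hi := by rw [lie_neg, lie_neg, h.t_t_e i hi]

theorem exists_isDoubledUnits [IsAddTorsionFree L] (h : IsIChevalley d e f t) :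
    ∃ X B : Fin (n + 1) → Fin (n + 1) → L, IsDoubledUnits X B ∧ IsChevalleyUnits X d e f ∧
      B (Fin.last n) (Fin.last n) = t := by
  obtain ⟨X, hX⟩ := h.exists_isChevalleyUnits
  have ht := h.isCornerUnit hX
  have hB := ht.unitBrackets hX.units
  have hcol := h.lie_lie_column hX
  have hrow := h.dual.lie_lie_column hX.dual
  simp only [lie_neg, neg_inj] at hrow
  refine ⟨X, orbitUnits X (Fin.last n) t, hX.units.isDoubledUnits hB (N := Fin.last n) ?_, hX,
    ht.orbitUnits_self⟩
  exact UnitBrackets.lie_corner_eq hX.units hB (by simpa only [ht.orbitUnits_self] using hcol)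
    (by simpa only [ht.orbitUnits_self] using hrow)

end IsIChevalley

theorem IsDoubledUnits.isIChevalley (h : IsDoubledUnits X B) (hX : IsChevalleyUnits X d e f) :
    IsIChevalley d e f (B (Fin.last n) (Fin.last n)) where
  toIsChevalley := hX.isChevalley
  t_d i := by rw [← hX.diag, ← lie_skew, h.mixed]; grind
  t_e i hi := by rw [← hX.upper, ← lie_skew, h.mixed]; grind
  t_f i hi := by rw [← hX.lower, ← lie_skew, h.mixed]; grind
  e_e_t i hi := by
    rw [← hX.upper]
    exact h.mixed.lie_lie_eq_zero Fin.castSucc_lt_succ.ne (Or.inr (by grind))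
  f_f_t i hi := by
    rw [← hX.lower]
    exact h.mixed.lie_lie_eq_zero Fin.castSucc_lt_succ.ne' (Or.inl (by grind))
  t_t_e i hi := by
    have hsucc : i.succ = Fin.last n := Fin.ext hi
    have hne : i.castSucc ≠ Fin.last n := hsucc ▸ Fin.castSucc_lt_succ.ne
    rw [← hX.upper, hsucc, ← lie_skew _ (X _ _), h.mixed, if_pos rfl, if_neg hne.symm, sub_zero,
      lie_neg, h.twisted, if_neg hne.symm, if_pos rfl, zero_sub, neg_neg]
  t_t_f i hi := by
    have hsucc : i.succ = Fin.last n := Fin.ext hi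
    have hne : i.castSucc ≠ Fin.last n := hsucc ▸ Fin.castSucc_lt_succ.ne
    rw [← hX.lower, hsucc, ← lie_skew _ (X _ _), h.mixed, if_neg hne, if_pos rfl, zero_sub,
      neg_neg, h.twisted, if_pos rfl, if_neg hne, sub_zero]

end IChevalley

section Lift

open Module

variable {R L M ι : Type*} [CommRing R] [LieRing L] [LieAlgebra R L] [LieRing M] [LieAlgebra R M]
  [DecidableEq ι]

theorem UnitBrackets.map {X Y Z : ι → ι → L} (h : UnitBrackets X Y Z) (g : L →ₗ⁅R⁆ M) :
    UnitBrackets (fun i j => g (X i j)) (fun i j => g (Y i j)) fun i j => g (Z i j) :=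
  fun i j k l => by rw [← LieHom.map_lie, h, map_sub, apply_ite g, apply_ite g, map_zero]

theorem IsDoubledUnits.map {X B : ι → ι → L} (h : IsDoubledUnits X B) (g : L →ₗ⁅R⁆ M) :
    IsDoubledUnits (fun i j => g (X i j)) fun i j => g (B i j) where
  units := h.units.map g
  mixed := h.mixed.map g
  twisted := h.twisted.map g

theorem IsChevalleyUnits.map {n : ℕ} {X : Fin (n + 1) → Fin (n + 1) → L} {d : Fin (n + 1) → L}
    {e f : Fin n → L} (h : IsChevalleyUnits X d e f) (g : L →ₗ⁅R⁆ M) :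
    IsChevalleyUnits (fun i j => g (X i j)) (fun i => g (d i)) (fun i => g (e i))
      fun i => g (f i) where
  units := UnitBrackets.map h.units g
  diag i := congrArg g (h.diag i)
  upper i := congrArg g (h.upper i)
  lower i := congrArg g (h.lower i)

theorem map_lie_of_basis {κ : Type*} (b : Basis κ R L) {g : L →ₗ[R] M}
    (h : ∀ i j, g ⁅b i, b j⁆ = ⁅g (b i), g (b j)⁆) (x y : L) : g ⁅x, y⁆ = ⁅g x, g y⁆ := by
  have heq : (LieAlgebra.ad R L : L →ₗ[R] End R L).compr₂ g =
      (LieAlgebra.ad R M : M →ₗ[R] End R M).compl₁₂ g g := LinearMap.ext_basis b b h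
  exact LinearMap.congr_fun₂ heq x y

namespace IsDoubledUnits

variable {b : Basis (ι × ι ⊕ ι × ι) R L} {X B : ι → ι → M}

/-- The homomorphism to `M` from a Lie algebra with a basis of doubled matrix units which is
prescribed by doubled matrix units in `M`. -/
noncomputable def lift (hb : IsDoubledUnits (fun i j => b (.inl (i, j))) fun i j => b (.inr (i, j)))
    (h : IsDoubledUnits X B) : L →ₗ⁅R⁆ M where
  toLinearMap := b.constr R (Sum.elim (fun p => X p.1 p.2) fun p => B p.1 p.2)
  map_lie' {x y} := by
    refine map_lie_of_basis b ?_ x y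
    rintro (⟨i, j⟩ | ⟨i, j⟩) (⟨k, l⟩ | ⟨k, l⟩)
    · rw [hb.units i j k l]
      simp only [map_sub, apply_ite (b.constr R _), map_zero, b.constr_basis, Sum.elim_inl]
      exact (h.units i j k l).symm
    · rw [hb.mixed i j k l]
      simp only [map_sub, apply_ite (b.constr R _), map_zero, b.constr_basis, Sum.elim_inl,
        Sum.elim_inr]
      exact (h.mixed i j k l).symm
    · rw [hb.mixed.symm i j k l]
      simp only [map_sub, apply_ite (b.constr R _), map_zero, b.constr_basis, Sum.elim_inl,
        Sum.elim_inr]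
      exact (h.mixed.symm i j k l).symm
    · rw [hb.twisted i j k l]
      simp only [map_sub, apply_ite (b.constr R _), map_zero, b.constr_basis, Sum.elim_inl,
        Sum.elim_inr]
      exact (h.twisted i j k l).symm

theorem lift_inl (hb : IsDoubledUnits (fun i j => b (.inl (i, j))) fun i j => b (.inr (i, j)))
    (h : IsDoubledUnits X B) (i j : ι) : hb.lift h (b (.inl (i, j))) = X i j :=
  b.constr_basis R _ _

theorem lift_inr (hb : IsDoubledUnits (fun i j => b (.inl (i, j))) fun i j => b (.inr (i, j)))
    (h : IsDoubledUnits X B) (i j : ι) : hb.lift h (b (.inr (i, j))) = B i j :=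
  b.constr_basis R _ _

section ChevalleyUnits

variable {n : ℕ} {b : Basis (Fin (n + 1) × Fin (n + 1) ⊕ Fin (n + 1) × Fin (n + 1)) R L}
  {X B : Fin (n + 1) → Fin (n + 1) → M} {d : Fin (n + 1) → L} {e f : Fin n → L}
  {d' : Fin (n + 1) → M} {e' f' : Fin n → M}

theorem lift_diag (hb : IsDoubledUnits (fun i j => b (.inl (i, j))) fun i j => b (.inr (i, j)))
    (h : IsDoubledUnits X B) (hd : IsChevalleyUnits (fun i j => b (.inl (i, j))) d e f)
    (hX : IsChevalleyUnits X d' e' f') (i : Fin (n + 1)) : hb.lift h (d i) = d' i := by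
  rw [← hd.diag, hb.lift_inl, hX.diag]

theorem lift_upper (hb : IsDoubledUnits (fun i j => b (.inl (i, j))) fun i j => b (.inr (i, j)))
    (h : IsDoubledUnits X B) (hd : IsChevalleyUnits (fun i j => b (.inl (i, j))) d e f)
    (hX : IsChevalleyUnits X d' e' f') (i : Fin n) : hb.lift h (e i) = e' i := by
  rw [← hd.upper, hb.lift_inl, hX.upper]

theorem lift_lower (hb : IsDoubledUnits (fun i j => b (.inl (i, j))) fun i j => b (.inr (i, j)))
    (h : IsDoubledUnits X B) (hd : IsChevalleyUnits (fun i j => b (.inl (i, j))) d e f)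
    (hX : IsChevalleyUnits X d' e' f') (i : Fin n) : hb.lift h (f i) = f' i := by
  rw [← hd.lower, hb.lift_inl, hX.lower]

theorem eq_top_of_mem
    (hb : IsDoubledUnits (fun i j => b (.inl (i, j))) fun i j => b (.inr (i, j)))
    (hX : IsChevalleyUnits (fun i j => b (.inl (i, j))) d e f) {S : LieSubalgebra R L}
    (hd : ∀ i, d i ∈ S) (he : ∀ i, e i ∈ S) (hf : ∀ i, f i ∈ S)
    (ht : b (.inr (Fin.last n, Fin.last n)) ∈ S) : S = ⊤ := by
  have hunits : ∀ i j, b (.inl (i, j)) ∈ S := fun i j =>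
    hX.lie_induction (p := (· ∈ S)) (fun _ _ => S.lie_mem) (fun _ => hd i) (fun k _ _ => he k)
      fun k _ _ => hf k
  have hcorner : ∀ (P : Prop) [Decidable P],
      (if P then b (.inr (Fin.last n, Fin.last n)) else 0) ∈ S := fun P _ => by
    split_ifs
    exacts [ht, S.zero_mem]
  have hcolumn : ∀ i, b (.inr (i, Fin.last n)) ∈ S := fun i => by
    rw [hb.mixed.column_eq (Fin.last n) i]
    exact S.add_mem (S.lie_mem (hunits _ _) ht) (hcorner _)
  have hall : ∀ i j, b (.inr (i, j)) ∈ S := fun i j => by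
    rw [hb.mixed.eq_sub_lie (Fin.last n) i j]
    exact S.sub_mem (hcorner _) (S.lie_mem (hunits _ _) (hcolumn i))
  suffices ⊤ ≤ S.toSubmodule from eq_top_iff.2 fun x _ => this Submodule.mem_top
  rw [← b.span_eq, Submodule.span_le]
  rintro _ ⟨⟨i, j⟩ | ⟨i, j⟩, rfl⟩
  exacts [hunits i j, hall i j]

end ChevalleyUnits

end IsDoubledUnits

end Lift

section FixedPoints

open Matrix Module

/-- The numbering of the rows and columns of `gl_{2n}` by two copies of `1, …, n`, for which `theta`
exchanges the copies: `.inl i` and `.inr i` stand for `i` and `2n + 1 - i`. -/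
def foldEquiv (n : ℕ) : Fin n ⊕ Fin n ≃ Fin (2 * n) :=
  (Equiv.sumCongr (.refl _) Fin.revPerm).trans (finSumFinEquiv.trans (finCongr (two_mul n).symm))

theorem val_foldEquiv_inl {n : ℕ} (i : Fin n) : (foldEquiv n (.inl i) : ℕ) = i := rfl

theorem val_foldEquiv_inr {n : ℕ} (i : Fin n) : (foldEquiv n (.inr i) : ℕ) = 2 * n - (i + 1) := by
  simp only [foldEquiv, Equiv.trans_apply, Equiv.sumCongr_apply, Sum.map_inr, Fin.revPerm_apply,
    finSumFinEquiv_apply_right, finCongr_apply, Fin.val_cast, Fin.val_natAdd, Fin.val_rev]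
  omega

theorem rev_foldEquiv {n : ℕ} (s : Fin n ⊕ Fin n) : (foldEquiv n s).rev = foldEquiv n s.swap := by
  rcases s with i | i <;> ext <;>
    simp only [Fin.val_rev, Sum.swap_inl, Sum.swap_inr, val_foldEquiv_inl, val_foldEquiv_inr]
  all_goals omega

/-- The element of `gl_{2n}` with the given blocks in the numbering `foldEquiv`. -/
def foldBlocks {n : ℕ} (a b c d : Matrix (Fin n) (Fin n) ℂ) : Gl n :=
  reindexLieEquiv (R := ℂ) (foldEquiv n) (fromBlocks a b c d)

theorem foldBlocks_apply {n : ℕ} (a b c d : Matrix (Fin n) (Fin n) ℂ) (s r : Fin n ⊕ Fin n) :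
    foldBlocks a b c d (foldEquiv n s) (foldEquiv n r) = fromBlocks a b c d s r := by
  simp [foldBlocks]

theorem ext_foldEquiv {n : ℕ} {x y : Gl n}
    (h : ∀ s r, x (foldEquiv n s) (foldEquiv n r) = y (foldEquiv n s) (foldEquiv n r)) : x = y :=
  Matrix.ext <| (foldEquiv n).forall_congr_right.1 fun s => (foldEquiv n).forall_congr_right.1 (h s)

theorem theta_foldBlocks {n : ℕ} (a b c d : Matrix (Fin n) (Fin n) ℂ) :
    theta n (foldBlocks a b c d) = foldBlocks d c b a := by
  refine ext_foldEquiv fun s r => ?_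
  simp only [theta, reindexLieEquiv_apply, reindex_apply, submatrix_apply, Fin.revPerm_symm,
    Fin.revPerm_apply, rev_foldEquiv, foldBlocks_apply]
  rcases s with s | s <;> rcases r with r | r <;> rfl

theorem exists_eq_foldBlocks {n : ℕ} (x : Gl n) : ∃ a b c d, x = foldBlocks a b c d := by
  obtain ⟨y, rfl⟩ := (reindexLieEquiv (R := ℂ) (foldEquiv n)).surjective x
  exact ⟨_, _, _, _, congrArg _ (fromBlocks_toBlocks y).symm⟩

theorem foldBlocks_inj {n : ℕ} {a b c d a' b' c' d' : Matrix (Fin n) (Fin n) ℂ} :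
    foldBlocks a b c d = foldBlocks a' b' c' d' ↔ a = a' ∧ b = b' ∧ c = c' ∧ d = d' :=
  (reindexLieEquiv (R := ℂ) (foldEquiv n)).injective.eq_iff.trans fromBlocks_inj

/-- The fixed point of `theta` with a given diagonal and off-diagonal block. -/
def ofBlocks (n : ℕ) :
    Matrix (Fin n) (Fin n) ℂ × Matrix (Fin n) (Fin n) ℂ →ₗ[ℂ] fixedSubalgebra n where
  toFun p := ⟨foldBlocks p.1 p.2 p.2 p.1, theta_foldBlocks _ _ _ _⟩
  map_add' _ _ := Subtype.ext <|
    (congrArg _ (fromBlocks_add _ _ _ _ _ _ _ _).symm).trans (map_add _ _ _)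
  map_smul' c _ := Subtype.ext <|
    (congrArg _ (fromBlocks_smul c _ _ _ _).symm).trans (map_smul _ _ _)

theorem coe_ofBlocks {n : ℕ} (p : Matrix (Fin n) (Fin n) ℂ × Matrix (Fin n) (Fin n) ℂ) :
    (ofBlocks n p : Gl n) = foldBlocks p.1 p.2 p.2 p.1 := rfl

theorem bijective_ofBlocks (n : ℕ) : Function.Bijective (ofBlocks n) := by
  refine ⟨fun p q h => ?_, fun ⟨x, hx⟩ => ?_⟩
  · obtain ⟨hdiag, hoff, -⟩ := foldBlocks_inj.1 (congrArg Subtype.val h)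
    exact Prod.ext hdiag hoff
  · obtain ⟨a, b, c, d, rfl⟩ := exists_eq_foldBlocks x
    obtain ⟨rfl, rfl, -⟩ := foldBlocks_inj.1 ((theta_foldBlocks a b c d).symm.trans hx)
    exact ⟨(_, _), rfl⟩

theorem lie_ofBlocks {n : ℕ} (p q : Matrix (Fin n) (Fin n) ℂ × Matrix (Fin n) (Fin n) ℂ) :
    ⁅ofBlocks n p, ofBlocks n q⁆ =
      ofBlocks n (⁅p.1, q.1⁆ + ⁅p.2, q.2⁆, ⁅p.1, q.2⁆ + ⁅p.2, q.1⁆) := by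
  refine Subtype.ext ?_
  rw [LieSubalgebra.coe_bracket, coe_ofBlocks, coe_ofBlocks, coe_ofBlocks]
  rw [foldBlocks, foldBlocks, ← LieEquiv.map_lie, foldBlocks, Ring.lie_def, fromBlocks_multiply,
    fromBlocks_multiply, sub_eq_add_neg, fromBlocks_neg, fromBlocks_add]
  simp only [Ring.lie_def]
  congr 2 <;> abel

theorem isMatrixUnits_single (R ι : Type*) [CommRing R] [Fintype ι] [DecidableEq ι] :
    IsMatrixUnits fun i j : ι => single i j (1 : R) := fun i j k l => by
  have hmul : ∀ i j k l : ι, single i j (1 : R) * single k l 1 =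
      if j = k then single i l 1 else 0 := fun i j k l => by
    split_ifs with h
    · rw [h, single_mul_single_same, one_mul]
    · rw [single_mul_single_of_ne _ _ _ _ h]
  rw [Ring.lie_def, hmul, hmul]

/-- The basis of the fixed points consisting of the matrices which have a matrix unit as one of
their two blocks and vanish in the other. -/
noncomputable def fixedBasis (n : ℕ) :
    Basis (Fin n × Fin n ⊕ Fin n × Fin n) ℂ (fixedSubalgebra n) :=
  ((stdBasis ℂ (Fin n) (Fin n)).prod (stdBasis ℂ (Fin n) (Fin n))).map
    (.ofBijective (ofBlocks n) (bijective_ofBlocks n))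

theorem fixedBasis_inl {n : ℕ} (i j : Fin n) :
    fixedBasis n (.inl (i, j)) = ofBlocks n (single i j 1, 0) := by
  simp [fixedBasis, stdBasis_eq_single]

theorem fixedBasis_inr {n : ℕ} (i j : Fin n) :
    fixedBasis n (.inr (i, j)) = ofBlocks n (0, single i j 1) := by
  simp [fixedBasis, stdBasis_eq_single]

theorem isDoubledUnits_fixedBasis (n : ℕ) :
    IsDoubledUnits (fun i j => fixedBasis n (.inl (i, j)))
      fun i j => fixedBasis n (.inr (i, j)) := by
  have h := isMatrixUnits_single ℂ (Fin n)
  constructor <;> intro i j k l <;>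
    simp only [fixedBasis_inl, fixedBasis_inr, lie_ofBlocks, lie_zero, zero_lie, add_zero,
      zero_add] <;>
    rw [h i j k l] <;>
    split_ifs <;> simp [← map_sub, ← map_neg, Prod.mk_zero_zero]

theorem coe_fixedBasis_inl {n : ℕ} (i j : Fin n) :
    (fixedBasis n (.inl (i, j)) : Gl n) =
      matUnit n (i + 1) (j + 1) + matUnit n (2 * n - i) (2 * n - j) := by
  rw [fixedBasis_inl, coe_ofBlocks]
  refine ext_foldEquiv fun s r => ?_
  rw [foldBlocks_apply]
  rcases s with s | s <;> rcases r with r | r <;>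
    simp only [fromBlocks_apply₁₁, fromBlocks_apply₁₂, fromBlocks_apply₂₁, fromBlocks_apply₂₂,
      matUnit, single_apply, Matrix.add_apply, of_apply, Matrix.zero_apply, val_foldEquiv_inl,
      val_foldEquiv_inr, Fin.ext_iff] <;>
    grind

theorem coe_fixedBasis_inr {n : ℕ} (i j : Fin n) :
    (fixedBasis n (.inr (i, j)) : Gl n) =
      matUnit n (i + 1) (2 * n - j) + matUnit n (2 * n - i) (j + 1) := by
  rw [fixedBasis_inr, coe_ofBlocks]
  refine ext_foldEquiv fun s r => ?_
  rw [foldBlocks_apply]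
  rcases s with s | s <;> rcases r with r | r <;>
    simp only [fromBlocks_apply₁₁, fromBlocks_apply₁₂, fromBlocks_apply₂₁, fromBlocks_apply₂₂,
      matUnit, single_apply, Matrix.add_apply, of_apply, Matrix.zero_apply, val_foldEquiv_inl,
      val_foldEquiv_inr, Fin.ext_iff] <;>
    grind

end FixedPoints

section Generators

/-- The generators as elements of `gl_{2n}^θ`. -/
def genFixed (n : ℕ) (g : Gen n) : fixedSubalgebra n := ⟨genMat n g, genMat_mem n g⟩

theorem isChevalleyUnits_fixedBasis (n : ℕ) :
    IsChevalleyUnits (fun i j => fixedBasis (n + 1) (.inl (i, j)))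
      (fun i => genFixed (n + 1) (.d i)) (fun i => genFixed (n + 1) (.e i))
      fun i => genFixed (n + 1) (.f i) where
  units := (isDoubledUnits_fixedBasis (n + 1)).units
  diag i := Subtype.ext <| (coe_fixedBasis_inl _ _).trans <| by
    simp only [genFixed, genMat, chevH]
    grind
  upper i := Subtype.ext <| (coe_fixedBasis_inl _ _).trans <| by
    simp only [genFixed, genMat, chevE, chevF]
    grind
  lower i := Subtype.ext <| (coe_fixedBasis_inl _ _).trans <| by
    simp only [genFixed, genMat, chevE, chevF]
    grind

theorem fixedBasis_inr_last (n : ℕ) :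
    fixedBasis (n + 1) (.inr (Fin.last n, Fin.last n)) = genFixed (n + 1) .t :=
  Subtype.ext <| (coe_fixedBasis_inr _ _).trans <| by
    simp only [genFixed, genMat, chevE, chevF]
    grind

theorem lieSpan_range_genFixed (n : ℕ) :
    LieSubalgebra.lieSpan ℂ _ (Set.range (genFixed (n + 1))) = ⊤ := by
  have hgen : ∀ g, genFixed (n + 1) g ∈
      LieSubalgebra.lieSpan ℂ _ (Set.range (genFixed (n + 1))) :=
    fun g => LieSubalgebra.subset_lieSpan ⟨g, rfl⟩
  exact (isDoubledUnits_fixedBasis (n + 1)).eq_top_of_mem (isChevalleyUnits_fixedBasis n)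
    (fun i => hgen (.d i)) (fun i => hgen (.e i)) (fun i => hgen (.f i))
    (fixedBasis_inr_last n ▸ hgen .t)

end Generators

section Relations

variable {A : Type*} [Ring A]

theorem lie_lie_eq (x y : A) : ⁅x, ⁅x, y⁆⁆ = x ^ 2 * y - 2 * (x * y * x) + y * x ^ 2 := by
  simp only [Ring.lie_def]
  noncomm_ring

theorem lie_lie_eq' (x y : A) : ⁅x, ⁅x, y⁆⁆ = y * x ^ 2 - 2 * (x * y * x) + x ^ 2 * y := by
  rw [lie_lie_eq]
  abel

theorem abs_natCast_sub_eq_one {i j : ℕ} : |(i : ℤ) - j| = 1 ↔ i + 1 = j ∨ j + 1 = i := by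
  rw [abs_eq zero_le_one]
  omega

theorem one_lt_abs_natCast_sub {i j : ℕ} : 1 < |(i : ℤ) - j| ↔ i + 1 < j ∨ j + 1 < i := by
  rw [lt_abs]
  omega

theorem delta_sub_smul {M : Type*} [AddCommGroup M] [Module ℂ M] (i j k : ℕ) (x : M) :
    (delta i j - delta i k) • x = (if i = j then x else 0) - if i = k then x else 0 := by
  simp only [delta, sub_smul, ite_smul, one_smul, zero_smul]

variable [Algebra ℂ A] {n : ℕ} {π : Free (n + 1) →ₐ[ℂ] A}

theorem isIChevalley_of_rel (hπ : ∀ ⦃x y⦄, Rel (n + 1) x y → π x = π y) :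
    IsIChevalley (fun i => π (d i)) (fun i : Fin n => π (e i)) (fun i : Fin n => π (f i))
      (π t) where
  d_e i j := by
    have := hπ (Rel.d_e (n := n + 1) i j)
    rw [map_sub, map_mul, map_mul, map_smul, ← Ring.lie_def, delta_sub_smul] at this
    simpa [Fin.ext_iff] using this
  d_f i j := by
    have := hπ (Rel.d_f (n := n + 1) i j)
    rw [map_sub, map_mul, map_mul, map_smul, ← Ring.lie_def, neg_add_eq_sub,
      delta_sub_smul] at this
    simpa [Fin.ext_iff] using this
  e_f i j := by
    have := hπ (Rel.e_f (n := n + 1) i j)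
    rw [map_sub, map_mul, map_mul, map_smul, ← Ring.lie_def, map_sub] at this
    rw [this, delta, ite_smul, one_smul, zero_smul]
    simp only [Fin.ext_iff]
    rfl
  e_e i j hij := by
    simpa [Ring.lie_def, sub_eq_zero] using
      hπ (Rel.e_e (n := n + 1) i j (one_lt_abs_natCast_sub.2 (.inl hij)))
  f_f i j hij := by
    simpa [Ring.lie_def, sub_eq_zero] using
      hπ (Rel.f_f (n := n + 1) i j (one_lt_abs_natCast_sub.2 (.inl hij)))
  serre_e i j hij := by
    simpa [map_ofNat π 2, lie_lie_eq] using
      hπ (Rel.serre_e (n := n + 1) i j (abs_natCast_sub_eq_one.2 hij))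
  serre_f i j hij := by
    simpa [map_ofNat π 2, lie_lie_eq] using
      hπ (Rel.serre_f (n := n + 1) i j (abs_natCast_sub_eq_one.2 hij))
  t_d i := by simpa [Ring.lie_def, sub_eq_zero] using hπ (Rel.t_d (n := n + 1) i)
  t_e i hi := by simpa [Ring.lie_def, sub_eq_zero] using hπ (Rel.t_e (n := n + 1) i (by lia))
  t_f i hi := by simpa [Ring.lie_def, sub_eq_zero] using hπ (Rel.t_f (n := n + 1) i (by lia))
  e_e_t i hi := by simpa [map_ofNat π 2, lie_lie_eq] using hπ (Rel.e_e_t (n := n + 1) i (by lia))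
  f_f_t i hi := by simpa [map_ofNat π 2, lie_lie_eq] using hπ (Rel.f_f_t (n := n + 1) i (by lia))
  t_t_e i hi := by simpa [map_ofNat π 2, lie_lie_eq'] using hπ (Rel.e_t_t (n := n + 1) i (by lia))
  t_t_f i hi := by simpa [map_ofNat π 2, lie_lie_eq'] using hπ (Rel.f_t_t (n := n + 1) i (by lia))

theorem IsIChevalley.eq_of_rel
    (h : IsIChevalley (fun i => π (d i)) (fun i : Fin n => π (e i)) (fun i : Fin n => π (f i))
      (π t))
    {x y : Free (n + 1)} (hxy : Rel (n + 1) x y) : π x = π y := by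
  have hcomm : ∀ {a b : A}, ⁅a, b⁆ = 0 → a * b = b * a := sub_eq_zero.1
  induction hxy with
  | t_d i => simpa using hcomm (h.t_d i)
  | d_e i j =>
    rw [map_sub, map_mul, map_mul, map_smul, ← Ring.lie_def, delta_sub_smul]
    simpa [Fin.ext_iff] using h.d_e i j
  | d_f i j =>
    rw [map_sub, map_mul, map_mul, map_smul, ← Ring.lie_def, neg_add_eq_sub, delta_sub_smul]
    simpa [Fin.ext_iff] using h.d_f i j
  | t_e i hi => simpa using hcomm (h.t_e i (by omega))
  | t_f i hi => simpa using hcomm (h.t_f i (by omega))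
  | e_e i j hij =>
    rw [map_mul, map_mul]
    rcases one_lt_abs_natCast_sub.1 hij with hij | hij
    · exact hcomm (h.e_e i j hij)
    · exact (hcomm (h.e_e j i hij)).symm
  | f_f i j hij =>
    rw [map_mul, map_mul]
    rcases one_lt_abs_natCast_sub.1 hij with hij | hij
    · exact hcomm (h.f_f i j hij)
    · exact (hcomm (h.f_f j i hij)).symm
  | e_f i j =>
    rw [map_sub, map_mul, map_mul, map_smul, ← Ring.lie_def, map_sub, delta, ite_smul, one_smul,
      zero_smul]
    simp only [← Fin.ext_iff]
    exact h.e_f i j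
  | serre_e i j hij =>
    simpa [map_ofNat π 2, lie_lie_eq] using h.serre_e i j (abs_natCast_sub_eq_one.1 hij)
  | serre_f i j hij =>
    simpa [map_ofNat π 2, lie_lie_eq] using h.serre_f i j (abs_natCast_sub_eq_one.1 hij)
  | e_e_t i hi => simpa [map_ofNat π 2, lie_lie_eq] using h.e_e_t i (by omega)
  | f_f_t i hi => simpa [map_ofNat π 2, lie_lie_eq] using h.f_f_t i (by omega)
  | e_t_t i hi => simpa [map_ofNat π 2, lie_lie_eq'] using h.t_t_e i (by omega)
  | f_t_t i hi => simpa [map_ofNat π 2, lie_lie_eq'] using h.t_t_f i (by omega)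

end Relations

section Presentation

theorem adjoin_range_ι (R L : Type*) [CommRing R] [LieRing L] [LieAlgebra R L] :
    Algebra.adjoin R (Set.range (UniversalEnvelopingAlgebra.ι R : L → _)) = ⊤ := by
  set S := Algebra.adjoin R (Set.range (UniversalEnvelopingAlgebra.ι R : L → _))
  let ι' : L →ₗ⁅R⁆ S :=
    { toFun := fun x => ⟨UniversalEnvelopingAlgebra.ι R x, Algebra.subset_adjoin ⟨x, rfl⟩⟩
      map_add' := fun x y => Subtype.ext (map_add _ x y)
      map_smul' := fun c x => Subtype.ext (map_smul _ c x)
      map_lie' := fun {x y} => Subtype.ext (LieHom.map_lie _ x y) }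
  have hretract : S.val.comp (UniversalEnvelopingAlgebra.lift R ι') = AlgHom.id R _ := by
    ext x
    simp [ι']
  refine eq_top_iff.2 fun x _ => ?_
  rw [← AlgHom.id_apply (R := R) x, ← hretract]
  exact (UniversalEnvelopingAlgebra.lift R ι' x).2

theorem adjoin_ι_image_eq_top {R L : Type*} [CommRing R] [LieRing L] [LieAlgebra R L] {s : Set L}
    (hs : LieSubalgebra.lieSpan R L s = ⊤) :
    Algebra.adjoin R (UniversalEnvelopingAlgebra.ι R '' s) = ⊤ := by
  set S := Algebra.adjoin R (UniversalEnvelopingAlgebra.ι R '' s)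
  have hle : LieSubalgebra.lieSpan R L s ≤
      (lieSubalgebraOfSubalgebra R _ S).comap (UniversalEnvelopingAlgebra.ι R) :=
    LieSubalgebra.lieSpan_le.2 fun x hx => Algebra.subset_adjoin ⟨x, hx, rfl⟩
  rw [eq_top_iff, ← adjoin_range_ι, Algebra.adjoin_le_iff]
  rintro _ ⟨x, rfl⟩
  exact hle (hs ▸ LieSubalgebra.mem_top x)

theorem adjoin_range_genU (n : ℕ) : Algebra.adjoin ℂ (Set.range (genU (n + 1))) = ⊤ := by
  have h := adjoin_ι_image_eq_top (lieSpan_range_genFixed n)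
  rwa [← Set.range_comp] at h

theorem exists_presented_toUi (n : ℕ) : ∃ φ : Presented (n + 1) →ₐ[ℂ] Ui (n + 1),
    ∀ g, φ (Presented.gen (n + 1) g) = genU (n + 1) g := by
  have hlift : ∀ g, FreeAlgebra.lift ℂ (genU (n + 1)) (FreeAlgebra.ι ℂ g) = genU (n + 1) g :=
    FreeAlgebra.lift_ι_apply _
  have h := ((isDoubledUnits_fixedBasis (n + 1)).map (UniversalEnvelopingAlgebra.ι ℂ)).isIChevalley
    ((isChevalleyUnits_fixedBasis n).map (UniversalEnvelopingAlgebra.ι ℂ))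
  have hrel : IsIChevalley (fun i => FreeAlgebra.lift ℂ (genU (n + 1)) (d i))
      (fun i : Fin n => FreeAlgebra.lift ℂ (genU (n + 1)) (e i))
      (fun i : Fin n => FreeAlgebra.lift ℂ (genU (n + 1)) (f i))
      (FreeAlgebra.lift ℂ (genU (n + 1)) t) := by
    simp only [d, e, f, t, hlift]
    rwa [fixedBasis_inr_last] at h
  refine ⟨RingQuot.liftAlgHom ℂ ⟨FreeAlgebra.lift ℂ (genU (n + 1)), fun _ _ => hrel.eq_of_rel⟩,
    fun g => ?_⟩
  rw [Presented.gen, RingQuot.liftAlgHom_mkAlgHom_apply, hlift]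

theorem exists_ui_toPresented (n : ℕ) : ∃ ψ : Ui (n + 1) →ₐ[ℂ] Presented (n + 1),
    ∀ g, ψ (genU (n + 1) g) = Presented.gen (n + 1) g := by
  have : Module ℚ (Presented (n + 1)) := Module.compHom _ (algebraMap ℚ ℂ)
  have : IsAddTorsionFree (Presented (n + 1)) := .of_module_rat _
  obtain ⟨X, B, h, hX, ht⟩ := (isIChevalley_of_rel (π := RingQuot.mkAlgHom ℂ (Rel (n + 1)))
    fun _ _ => RingQuot.mkAlgHom_rel ℂ).exists_isDoubledUnits
  have hb := isDoubledUnits_fixedBasis (n + 1)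
  have hgen := isChevalleyUnits_fixedBasis n
  refine ⟨UniversalEnvelopingAlgebra.lift ℂ (hb.lift h), fun g => ?_⟩
  suffices hb.lift h (genFixed (n + 1) g) = Presented.gen (n + 1) g from
    (UniversalEnvelopingAlgebra.lift_ι_apply ℂ _ _).trans this
  cases g with
  | e i => exact hb.lift_upper h hgen hX i
  | f i => exact hb.lift_lower h hgen hX i
  | t => rw [← fixedBasis_inr_last, hb.lift_inr, ht]; rfl
  | d i => exact hb.lift_diag h hgen hX i

end Presentation

end EvenFixedPoint

theorem mainTheorem3 (n : ℕ) (hn : 1 ≤ n) :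
    Algebra.adjoin ℂ (Set.range (EvenFixedPoint.genU n)) = ⊤ ∧
      ∃ φ : EvenFixedPoint.Presented n ≃ₐ[ℂ] EvenFixedPoint.Ui n,
        ∀ g : EvenFixedPoint.Gen n, φ (EvenFixedPoint.Presented.gen n g) = EvenFixedPoint.genU n g := by
  obtain ⟨m, rfl⟩ := Nat.exists_eq_add_of_le' hn
  have hgen := EvenFixedPoint.adjoin_range_genU m
  obtain ⟨φ, hφ⟩ := EvenFixedPoint.exists_presented_toUi m
  obtain ⟨ψ, hψ⟩ := EvenFixedPoint.exists_ui_toPresented m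
  have hφψ : φ.comp ψ = AlgHom.id ℂ _ := by
    refine AlgHom.ext_of_adjoin_eq_top hgen ?_
    rintro _ ⟨g, rfl⟩
    simp [hφ, hψ]
  have hψφ : ψ.comp φ = AlgHom.id ℂ _ := by
    refine RingQuot.ringQuot_ext' ℂ _ _ (FreeAlgebra.hom_ext (funext fun g => ?_))
    change ψ (φ (EvenFixedPoint.Presented.gen _ g)) = EvenFixedPoint.Presented.gen _ g
    rw [hφ, hψ]
  exact ⟨hgen, AlgEquiv.ofAlgHom φ ψ hφψ hψφ, hφ⟩
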